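/- Let $\mathbb{H}$ be the quaternions and let $V$ be a right quaternionic Banach space (in particular, $V$ may be any right quaternionic Hilbert space $V_{\mathbb{H}}^R$): a complete normed space with a right multiplication by quaternions satisfying $\|\phi q\|=\|\phi\|\,|q|$. Let $B(V)$ be the set of bounded right $\mathbb{H}$-linear operators on $V$. For $A\in B(V)$ and $q\in\mathbb{H}$ put $$R_q(A)=A^2-2\,\mathrm{Re}(q)\,A+|q|^2 I,$$ and let $\sigma_S(A)$ be the set of all $q\in\mathbb{H}$ for which $R_q(A)$ has no inverse in $B(V)$. The operator $A$ is called decomposable if for any two open sets $U_1,U_2\subseteq\mathbb{H}$ with $U_1\cup U_2=\mathbb{H}$ there are closed $A$-invariant right linear subspaces $Y,Z\subseteq V$ with $\sigma_S(A|_Y)\subseteq U_1$, $\sigma_S(A|_Z)\subseteq U_2$ and $V=Y+Z$. Let $U\subseteq\mathbb{H}$ be open. A function $f:U\to V$ is right slice-regular if it has partial derivatives in the four real coordinates and if, for every $I\in\mathbb{H}$ with $\mathrm{Re}\,I=0$ and $|I|=1$, its restriction $f_I$ to $U\cap\mathbb{C}_I$, where $\mathbb{C}_I=\mathbb{R}+I\mathbb{R}$,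 has continuous partial derivatives in $x$ and $y$ and satisfies $$\frac12\left(\frac{\partial f_I}{\partial x}(x+yI)+\frac{\partial f_I}{\partial y}(x+yI)\,I\right)=0\qquad\text{for } x+yI\in U\cap\mathbb{C}_I.$$ The operator $A$ has Bishop's property $(\beta)$ if, for every open set $U\subseteq\mathbb{H}$ and every sequence of continuous right slice-regular functions $f_n:U\to V$ such that $R_q(A)f_n(q)\to 0$ uniformly on every compact subset of $U$, one has $f_n\to 0$ locally uniformly on $U$. Theorem. Every decomposable operator $A\in B(V)$ has Bishop's property $(\beta)$. -/

import Mathlib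

open scoped Quaternion MulOpposite

namespace QuaternionicOperator

/-!
A right quaternionic Banach space is a complete normed group `V` with a right action of the
quaternions (an action of `ℍ[ℝ]ᵐᵒᵖ`, where `MulOpposite.op q • φ` is `φ q`) such that
`‖φ q‖ = ‖φ‖ |q|` (`NormSMulClass`); its real structure is the restriction of the quaternionic one
(`IsScalarTower ℝ ℍ[ℝ]ᵐᵒᵖ V`). Bounded right linear operators are `V →L[ℍ[ℝ]ᵐᵒᵖ] V`.
-/

section Operators

variable {V : Type*} [NormedAddCommGroup V] [NormedSpace ℝ V] [Module ℍ[ℝ]ᵐᵒᵖ V]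
  [IsScalarTower ℝ ℍ[ℝ]ᵐᵒᵖ V]

/-- The operator `R_q(A) = A² - 2 Re(q) A + |q|² I`. -/
noncomputable def pseudoResolvent (A : V →L[ℍ[ℝ]ᵐᵒᵖ] V) (q : ℍ[ℝ]) : V →L[ℍ[ℝ]ᵐᵒᵖ] V :=
  A ^ 2 - (2 * q.re) • A + (‖q‖ ^ 2) • (1 : V →L[ℍ[ℝ]ᵐᵒᵖ] V)

/-- The `S`-spectrum: the quaternions `q` for which `R_q(A)` has no bounded inverse. -/
def sSpectrum (A : V →L[ℍ[ℝ]ᵐᵒᵖ] V) : Set ℍ[ℝ] :=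
  {q | ¬ IsUnit (pseudoResolvent A q)}

/-- The restriction `A|Y` of `A` to an invariant right linear subspace `Y`. -/
noncomputable def restrictTo (A : V →L[ℍ[ℝ]ᵐᵒᵖ] V) (Y : Submodule ℍ[ℝ]ᵐᵒᵖ V) (hY : ∀ φ ∈ Y, A φ ∈ Y) :
    Y →L[ℍ[ℝ]ᵐᵒᵖ] Y :=
  A.restrict hY

/-- `A` is decomposable: every cover of the quaternions by two open sets `U₁`, `U₂` splits the
space as a (not necessarily direct) sum of two closed invariant right linear subspaces on which
the `S`-spectrum of `A` lies in `U₁` and in `U₂` respectively. -/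
def IsDecomposable (A : V →L[ℍ[ℝ]ᵐᵒᵖ] V) : Prop :=
  ∀ U₁ U₂ : Set ℍ[ℝ], IsOpen U₁ → IsOpen U₂ → U₁ ∪ U₂ = Set.univ →
    ∃ (Y Z : Submodule ℍ[ℝ]ᵐᵒᵖ V) (hY : ∀ φ ∈ Y, A φ ∈ Y) (hZ : ∀ φ ∈ Z, A φ ∈ Z),
      IsClosed (Y : Set V) ∧ IsClosed (Z : Set V) ∧
      sSpectrum (restrictTo A Y hY) ⊆ U₁ ∧ sSpectrum (restrictTo A Z hZ) ⊆ U₂ ∧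
      Y ⊔ Z = ⊤

end Operators

/-- The sphere of imaginary units. -/
def imaginaryUnits : Set ℍ[ℝ] := {I | I.re = 0 ∧ ‖I‖ = 1}

/-- The complex plane `ℂ_I = ℝ + I ℝ`. -/
def slicePlane (I : ℍ[ℝ]) : Set ℍ[ℝ] := {q | ∃ x y : ℝ, q = (x : ℍ[ℝ]) + (y : ℍ[ℝ]) * I}

section SliceRegular

variable {V : Type*} [NormedAddCommGroup V] [NormedSpace ℝ V] [Module ℍ[ℝ]ᵐᵒᵖ V]

/-- Right slice-regularity on an open set `U` of a function with values in `V`. At a point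
`q = x + y I` of `ℂ_I`, the partial derivatives of `f_I (x + y I)` in `x` and in `y` are the
derivatives of `f` at `q` along `1` and along `I`. Only the values of `f` on `U` matter. -/
structure IsRightSliceRegularOn (f : ℍ[ℝ] → V) (U : Set ℍ[ℝ]) : Prop where
  /-- `f` has partial derivatives in the four real coordinates. -/
  real_differentiable : ∀ q ∈ U,
    LineDifferentiableAt ℝ f q ⟨1, 0, 0, 0⟩ ∧ LineDifferentiableAt ℝ f q ⟨0, 1, 0, 0⟩ ∧
    LineDifferentiableAt ℝ f q ⟨0, 0, 1, 0⟩ ∧ LineDifferentiableAt ℝ f q ⟨0, 0, 0, 1⟩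
  /-- The restriction to each slice has partial derivatives in `x` and `y`. -/
  slice_differentiable : ∀ I ∈ imaginaryUnits, ∀ q ∈ U ∩ slicePlane I,
    LineDifferentiableAt ℝ f q 1 ∧ LineDifferentiableAt ℝ f q I
  /-- These partial derivatives are continuous on the slice. -/
  slice_continuous : ∀ I ∈ imaginaryUnits,
    ContinuousOn (fun q => lineDeriv ℝ f q 1) (U ∩ slicePlane I) ∧
    ContinuousOn (fun q => lineDeriv ℝ f q I) (U ∩ slicePlane I)
  /-- The right Cauchy-Riemann equation `(∂f_I/∂x + (∂f_I/∂y) I) / 2 = 0` on each slice. -/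
  cauchy_riemann : ∀ I ∈ imaginaryUnits, ∀ q ∈ U ∩ slicePlane I,
    (1 / 2 : ℝ) • (lineDeriv ℝ f q 1 + MulOpposite.op I • lineDeriv ℝ f q I) = 0

/-- Bishop's property (β). -/
def HasBishopProperty [IsScalarTower ℝ ℍ[ℝ]ᵐᵒᵖ V] (A : V →L[ℍ[ℝ]ᵐᵒᵖ] V) : Prop :=
  ∀ (U : Set ℍ[ℝ]), IsOpen U → ∀ f : ℕ → ℍ[ℝ] → V,
    (∀ n, ContinuousOn (f n) U ∧ IsRightSliceRegularOn (f n) U) →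
    (∀ K ⊆ U, IsCompact K →
      TendstoUniformlyOn (fun n q => pseudoResolvent A q (f n q)) 0 Filter.atTop K) →
    TendstoLocallyUniformlyOn f 0 Filter.atTop U

end SliceRegular

end QuaternionicOperator

/-!
Fix a point `p`. Decomposability, for the cover of `ℍ` by an open tube of radius `2 r` around the
sphere through `p` and the complement of the closed concentric tube of radius `r`, gives
`V = Y + Z`.

Outside the larger tube `R_q(A)` is invertible on `V / Z ≅ Y / (Y ∩ Z)`: it is invertible on `Y`,
and its inverse preserves `Y ∩ Z` since horizontal rays join `q` to infinity outside the tube. If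
`R_q(A) f(q)` is small, then `f(q)` is therefore close to `Z` for `q` outside the larger tube. On
every slice `f` is holomorphic, and the maximum principle in `V / Z` shows that `f(q)` is close to
`Z` for all `q` near `p`. In the smaller tube `R_q(A)` is invertible on `Z`, so `f(q)` is small.
-/

open Filter Topology Bornology

namespace QuaternionicOperator

section Companion

variable {𝒜 : Type*} [NormedRing 𝒜] [NormedAlgebra ℝ 𝒜]

/-- The value at `T` of the companion polynomial `X² - 2 Re(q) X + |q|²` of the quaternion `q`.
It is defined in real Banach algebras because `V →L[ℍ[ℝ]ᵐᵒᵖ] V`, where `pseudoResolvent` lives,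
carries no operator norm in Mathlib. -/
noncomputable def companion {𝒜 : Type*} [Ring 𝒜] [Algebra ℝ 𝒜] (T : 𝒜) (q : ℍ[ℝ]) : 𝒜 :=
  T ^ 2 - (2 * q.re) • T + (‖q‖ ^ 2) • (1 : 𝒜)

lemma continuous_companion (T : 𝒜) : Continuous (companion T) := by
  have := Quaternion.continuous_re
  unfold companion
  fun_prop

lemma norm_sq_eq_re_sq_add_norm_im_sq (q : ℍ[ℝ]) : ‖q‖ ^ 2 = q.re ^ 2 + ‖q.im‖ ^ 2 := by
  rw [pow_two ‖q‖, pow_two ‖q.im‖, ← Quaternion.normSq_eq_norm_mul_self,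
    ← Quaternion.normSq_eq_norm_mul_self, Quaternion.normSq_def', Quaternion.normSq_def']
  simp only [Quaternion.re_im, Quaternion.imI_im, Quaternion.imJ_im, Quaternion.imK_im]
  ring

lemma abs_re_le_norm (q : ℍ[ℝ]) : |q.re| ≤ ‖q‖ :=
  abs_le_of_sq_le_sq (norm_sq_eq_re_sq_add_norm_im_sq q ▸ le_add_of_nonneg_right (sq_nonneg _))
    (norm_nonneg q)

lemma tendsto_inv_norm_sq_smul_companion_cobounded (T : 𝒜) :
    Tendsto (fun q => (‖q‖⁻¹ ^ 2) • companion T q) (cobounded ℍ[ℝ]) (𝓝 1) := by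
  have hinv : Tendsto (fun q : ℍ[ℝ] => ‖q‖⁻¹) (cobounded ℍ[ℝ]) (𝓝 0) :=
    tendsto_inv_atTop_zero.comp tendsto_norm_cobounded_atTop
  have hre : Tendsto (fun q : ℍ[ℝ] => (2 * q.re) * ‖q‖⁻¹ ^ 2) (cobounded ℍ[ℝ]) (𝓝 0) := by
    refine squeeze_zero_norm (a := fun q => 2 * ‖q‖⁻¹) (fun q => ?_)
      (by simpa only [mul_zero] using hinv.const_mul 2)
    calc ‖(2 * q.re) * ‖q‖⁻¹ ^ 2‖ = 2 * (|q.re| * ‖q‖⁻¹) * ‖q‖⁻¹ := by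
          simp only [norm_mul, Real.norm_eq_abs, abs_two, norm_pow, norm_inv, abs_norm]
          ring
      _ ≤ 2 * 1 * ‖q‖⁻¹ := by
          gcongr
          exact mul_inv_le_one_of_le₀ (abs_re_le_norm q) (norm_nonneg q)
      _ = 2 * ‖q‖⁻¹ := by rw [mul_one]
  have hlim := ((hinv.pow 2).smul_const (T ^ 2)).sub (hre.smul_const T) |>.add_const 1
  simp only [ne_eq, OfNat.ofNat_ne_zero, not_false_eq_true, zero_pow, zero_smul, sub_zero,
    zero_add] at hlim
  refine hlim.congr' ?_
  filter_upwards [eventually_ne_cobounded (0 : ℍ[ℝ])] with q hq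
  have hone : ‖q‖⁻¹ ^ 2 * ‖q‖ ^ 2 = 1 := by
    rw [← mul_pow, inv_mul_cancel₀ (norm_ne_zero_iff.2 hq), one_pow]
  rw [companion, smul_add, smul_sub, smul_smul, smul_smul, hone, one_smul, mul_comm (2 * q.re)]

lemma eventually_isUnit_companion_cobounded [CompleteSpace 𝒜] (T : 𝒜) :
    ∀ᶠ q in cobounded ℍ[ℝ], IsUnit (companion T q) := by
  filter_upwards [(tendsto_inv_norm_sq_smul_companion_cobounded T).eventually
    (Units.nhds (1 : 𝒜ˣ)), eventually_ne_cobounded (0 : ℍ[ℝ])] with q hunit hq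
  exact (isUnit_smul_iff
    (Units.mk0 (‖q‖⁻¹ ^ 2) (pow_ne_zero 2 (inv_ne_zero (norm_ne_zero_iff.2 hq)))) _).1 hunit

-- Invertibility in `S` spreads over `Ω` from a point near infinity: it is an open condition, and
-- a closed one along `Ω` because inverses in `S` that converge in the big algebra converge in `S`.
lemma isUnit_companion_of_isClosed_subalgebra [CompleteSpace 𝒜] {S : Subalgebra ℝ 𝒜}
    (hS : IsClosed (S : Set 𝒜)) (T : S) {Ω : Set ℍ[ℝ]} (hΩ : IsPreconnected Ω)
    (hΩb : ¬ Bornology.IsBounded Ω) (hunit : ∀ q ∈ Ω, IsUnit (companion (T : 𝒜) q)) :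
    ∀ q ∈ Ω, IsUnit (companion T q) := by
  have : CompleteSpace S := hS.completeSpace_coe
  have hcont : Continuous (companion T) := continuous_companion T
  refine hΩ.subset_of_closure_inter_subset (u := {q | IsUnit (companion T q)})
    (Units.isOpen.preimage hcont) ?_ ?_
  · by_contra hempty
    refine hΩb (isBounded_def.2 ?_)
    filter_upwards [eventually_isUnit_companion_cobounded T] with q hq hqΩ
    exact hempty ⟨q, hqΩ, hq⟩
  · rintro q ⟨hqcl, hqΩ⟩
    have hne := mem_closure_iff_nhdsWithin_neBot.1 hqcl
    exact Subalgebra.isUnit_of_isUnit_val_of_eventually (S := S)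
      (l := map (companion T) (𝓝[{q | IsUnit (companion T q)}] q)) (hunit q hqΩ)
      ((map_mono nhdsWithin_le_nhds).trans hcont.continuousAt)
      (eventually_map.2 eventually_mem_nhdsWithin) (hne.map _)

variable {E : Type*} [NormedAddCommGroup E] [NormedSpace ℝ E]

/-- The algebra of bounded operators that leave the subspace `W` invariant. -/
def invariantSubalgebra (W : Submodule ℝ E) : Subalgebra ℝ (E →L[ℝ] E) where
  carrier := {B | ∀ w ∈ W, B w ∈ W}
  mul_mem' hB hC w hw := hB _ (hC w hw)
  add_mem' hB hC w hw := W.add_mem (hB w hw) (hC w hw)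
  algebraMap_mem' r _ hw := W.smul_mem r hw

lemma isClosed_invariantSubalgebra {W : Submodule ℝ E} (hW : IsClosed (W : Set E)) :
    IsClosed (invariantSubalgebra W : Set (E →L[ℝ] E)) := by
  have hinter : (invariantSubalgebra W : Set (E →L[ℝ] E)) = ⋂ w ∈ W, {B | B w ∈ W} := by
    ext B
    simp only [Set.mem_iInter]
    rfl
  rw [hinter]
  exact isClosed_biInter fun w _ => hW.preimage (ContinuousLinearMap.apply ℝ E w).continuous

variable [CompleteSpace E]

lemma mem_of_companion_apply_mem {T : E →L[ℝ] E} {W : Submodule ℝ E} (hWc : IsClosed (W : Set E))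
    (hW : ∀ w ∈ W, T w ∈ W) {Ω : Set ℍ[ℝ]} (hΩ : IsPreconnected Ω)
    (hΩb : ¬ Bornology.IsBounded Ω) (hunit : ∀ q ∈ Ω, IsUnit (companion T q)) {q : ℍ[ℝ]}
    (hq : q ∈ Ω) {w : E} (hw : companion T q w ∈ W) : w ∈ W := by
  obtain ⟨u, hu⟩ := isUnit_companion_of_isClosed_subalgebra (isClosed_invariantSubalgebra hWc)
    ⟨T, hW⟩ hΩ hΩb hunit q hq
  have hinv : ((↑u⁻¹ : invariantSubalgebra W) : E →L[ℝ] E) * companion T q = 1 := by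
    rw [← (invariantSubalgebra W).coe_one, ← u.inv_mul, hu]
    rfl
  have hmem : ((↑u⁻¹ : invariantSubalgebra W) : E →L[ℝ] E) (companion T q w) ∈ W :=
    (↑u⁻¹ : invariantSubalgebra W).2 _ hw
  rwa [← mul_apply_eq_comp, hinv, one_apply_eq_self] at hmem

lemma exists_norm_le_mul_norm_companion_apply (T : E →L[ℝ] E) {K : Set ℍ[ℝ]} (hK : IsCompact K)
    (hunit : ∀ q ∈ K, IsUnit (companion T q)) :
    ∃ M, 0 ≤ M ∧ ∀ q ∈ K, ∀ v, ‖v‖ ≤ M * ‖companion T q v‖ := by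
  have hcont : ContinuousOn (fun q => Ring.inverse (companion T q)) K := by
    intro q hq
    obtain ⟨u, hu⟩ := hunit q hq
    refine ContinuousAt.continuousWithinAt (ContinuousAt.comp (g := Ring.inverse) ?_
      (continuous_companion T).continuousAt)
    exact hu ▸ NormedRing.inverse_continuousAt u
  obtain ⟨M, hM⟩ := hK.exists_bound_of_continuousOn hcont
  refine ⟨max M 0, le_max_right _ _, fun q hq v => ?_⟩
  have hv : Ring.inverse (companion T q) (companion T q v) = v :=
    congrArg (fun B : E →L[ℝ] E => B v) (Ring.inverse_mul_cancel _ (hunit q hq))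
  calc ‖v‖ = ‖Ring.inverse (companion T q) (companion T q v)‖ := by rw [hv]
    _ ≤ max M 0 * ‖companion T q v‖ :=
      (Ring.inverse (companion T q)).le_of_opNorm_le ((hM q hq).trans (le_max_left _ _)) _

end Companion

section OpenMapping

variable {𝕜 E : Type*} [NontriviallyNormedField 𝕜] [NormedAddCommGroup E] [NormedSpace 𝕜 E]
  [CompleteSpace E]

lemma exists_add_eq_norm_le {Y Z : Submodule 𝕜 E} (hYc : IsClosed (Y : Set E))
    (hZc : IsClosed (Z : Set E)) (hYZ : Y ⊔ Z = ⊤) :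
    ∃ C, 0 ≤ C ∧ ∀ v, ∃ y ∈ Y, ∃ z ∈ Z, y + z = v ∧ ‖y‖ ≤ C * ‖v‖ := by
  have : CompleteSpace Y := hYc.completeSpace_coe
  have : CompleteSpace Z := hZc.completeSpace_coe
  have hsurj : Function.Surjective (Y.subtypeL.coprod Z.subtypeL) := fun v => by
    obtain ⟨y, hy, z, hz, rfl⟩ := Submodule.mem_sup.1 (hYZ ▸ Submodule.mem_top : v ∈ Y ⊔ Z)
    exact ⟨(⟨y, hy⟩, ⟨z, hz⟩), rfl⟩
  obtain ⟨C, hC, hpre⟩ := (Y.subtypeL.coprod Z.subtypeL).exists_preimage_norm_le hsurj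
  refine ⟨C, hC.le, fun v => ?_⟩
  obtain ⟨⟨y, z⟩, hyz, hnorm⟩ := hpre v
  exact ⟨y, y.2, z, z.2, hyz, (norm_fst_le (y, z)).trans hnorm⟩

end OpenMapping

section BoundedBelow

variable {E F 𝓕 : Type*} [SeminormedAddCommGroup E] [SeminormedAddCommGroup F] [FunLike 𝓕 E F]
  [AddMonoidHomClass 𝓕 E F]

lemma norm_le_mul_norm_apply_add_mul_infDist (T : 𝓕) {s : Set E} (hs : s.Nonempty) {M N : ℝ}
    (hM0 : 0 ≤ M) (hN0 : 0 ≤ N) (hN : ∀ v, ‖T v‖ ≤ N * ‖v‖) (hM : ∀ z ∈ s, ‖z‖ ≤ M * ‖T z‖)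
    (v : E) : ‖v‖ ≤ M * ‖T v‖ + (1 + M * N) * Metric.infDist v s := by
  rw [← sub_le_iff_le_add', ← div_le_iff₀' (by positivity), Metric.le_infDist hs]
  intro z hz
  rw [div_le_iff₀' (by positivity), sub_le_iff_le_add', dist_eq_norm]
  have hTz : ‖T z‖ ≤ ‖T v‖ + N * ‖v - z‖ :=
    calc ‖T z‖ = ‖T v - T (v - z)‖ := by rw [map_sub, sub_sub_cancel]
      _ ≤ ‖T v‖ + N * ‖v - z‖ := (norm_sub_le _ _).trans (by gcongr; exact hN _)
  calc ‖v‖ ≤ ‖z‖ + ‖v - z‖ := norm_le_norm_add_norm_sub' v z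
    _ ≤ M * (‖T v‖ + N * ‖v - z‖) + ‖v - z‖ := by
      gcongr
      exact (hM z hz).trans (by gcongr)
    _ = M * ‖T v‖ + (1 + M * N) * ‖v - z‖ := by ring

end BoundedBelow

section Operators

variable {V : Type*} [NormedAddCommGroup V] [NormedSpace ℝ V] [Module ℍ[ℝ]ᵐᵒᵖ V]
  [IsScalarTower ℝ ℍ[ℝ]ᵐᵒᵖ V] {A : V →L[ℍ[ℝ]ᵐᵒᵖ] V} {Y Z : Submodule ℍ[ℝ]ᵐᵒᵖ V}

/-- The points outside the `S`-spectrum of `A` that are connected to infinity there. For such `q`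
the inverse of `R_q(A)` preserves every closed subspace invariant under `A`. -/
def outerResolventSet (A : V →L[ℍ[ℝ]ᵐᵒᵖ] V) : Set ℍ[ℝ] :=
  {q | ¬ Bornology.IsBounded (connectedComponentIn (sSpectrum A)ᶜ q)}

lemma notMem_sSpectrum_of_mem_outerResolventSet {q : ℍ[ℝ]} (hq : q ∈ outerResolventSet A) :
    q ∉ sSpectrum A := by
  intro hqσ
  refine hq ?_
  rw [connectedComponentIn_eq_empty (not_not.2 hqσ)]
  exact Bornology.isBounded_empty

lemma companion_restrictScalars_apply (A : V →L[ℍ[ℝ]ᵐᵒᵖ] V) (q : ℍ[ℝ]) (v : V) :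
    companion (A.restrictScalars ℝ) q v = pseudoResolvent A q v := by
  simp [companion, pseudoResolvent, pow_two]

lemma isUnit_companion_of_notMem_sSpectrum {q : ℍ[ℝ]} (hq : q ∉ sSpectrum A) :
    IsUnit (companion (A.restrictScalars ℝ) q) := by
  let restrict : (V →L[ℍ[ℝ]ᵐᵒᵖ] V) →* (V →L[ℝ] V) :=
    { toFun := ContinuousLinearMap.restrictScalars ℝ
      map_one' := rfl
      map_mul' := fun _ _ => rfl }
  have hcompanion : companion (A.restrictScalars ℝ) q = restrict (pseudoResolvent A q) :=
    ContinuousLinearMap.ext (companion_restrictScalars_apply A q)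
  exact hcompanion ▸ (not_not.1 hq).map restrict

lemma exists_norm_pseudoResolvent_apply_le (A : V →L[ℍ[ℝ]ᵐᵒᵖ] V) {K : Set ℍ[ℝ]}
    (hK : IsCompact K) : ∃ N, 0 ≤ N ∧ ∀ q ∈ K, ∀ v, ‖pseudoResolvent A q v‖ ≤ N * ‖v‖ := by
  obtain ⟨N, hN⟩ := hK.exists_bound_of_continuousOn
    (continuous_companion (A.restrictScalars ℝ)).continuousOn
  refine ⟨max N 0, le_max_right _ _, fun q hq v => ?_⟩
  rw [← companion_restrictScalars_apply]
  exact (companion (A.restrictScalars ℝ) q).le_of_opNorm_le ((hN q hq).trans (le_max_left _ _)) v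

lemma coe_pseudoResolvent_restrictTo (hY : ∀ φ ∈ Y, A φ ∈ Y) (q : ℍ[ℝ]) (y : Y) :
    (pseudoResolvent (restrictTo A Y hY) q y : V) = pseudoResolvent A q y := by
  simp [pseudoResolvent, pow_two, restrictTo]

lemma pseudoResolvent_mem (hY : ∀ φ ∈ Y, A φ ∈ Y) (q : ℍ[ℝ]) {y : V} (hy : y ∈ Y) :
    pseudoResolvent A q y ∈ Y :=
  coe_pseudoResolvent_restrictTo hY q ⟨y, hy⟩ ▸ SetLike.coe_mem _

lemma exists_mem_pseudoResolvent_eq {hY : ∀ φ ∈ Y, A φ ∈ Y} {q : ℍ[ℝ]}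
    (hq : q ∉ sSpectrum (restrictTo A Y hY)) {w : V} (hw : w ∈ Y) :
    ∃ y ∈ Y, pseudoResolvent A q y = w := by
  obtain ⟨u, hu⟩ := not_not.1 hq
  refine ⟨(↑u⁻¹ : Y →L[ℍ[ℝ]ᵐᵒᵖ] Y) ⟨w, hw⟩, SetLike.coe_mem _, ?_⟩
  rw [← coe_pseudoResolvent_restrictTo hY, ← hu]
  exact congrArg (fun B : Y →L[ℍ[ℝ]ᵐᵒᵖ] Y => (B ⟨w, hw⟩ : V)) u.mul_inv

variable [CompleteSpace V]

lemma exists_norm_le_mul_norm_pseudoResolvent (hYc : IsClosed (Y : Set V))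
    (hY : ∀ φ ∈ Y, A φ ∈ Y) {K : Set ℍ[ℝ]} (hK : IsCompact K)
    (hKσ : Disjoint K (sSpectrum (restrictTo A Y hY))) :
    ∃ M, 0 ≤ M ∧ ∀ q ∈ K, ∀ y ∈ Y, ‖y‖ ≤ M * ‖pseudoResolvent A q y‖ := by
  have : CompleteSpace Y := hYc.completeSpace_coe
  obtain ⟨M, hM0, hM⟩ := exists_norm_le_mul_norm_companion_apply
    ((restrictTo A Y hY).restrictScalars ℝ) hK fun q hq =>
      isUnit_companion_of_notMem_sSpectrum (hKσ.notMem_of_mem_left hq)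
  refine ⟨M, hM0, fun q hq y hy => ?_⟩
  rw [← coe_pseudoResolvent_restrictTo hY q ⟨y, hy⟩, ← companion_restrictScalars_apply]
  exact hM q hq ⟨y, hy⟩

lemma mem_of_pseudoResolvent_mem (hYc : IsClosed (Y : Set V)) (hZc : IsClosed (Z : Set V))
    {hY : ∀ φ ∈ Y, A φ ∈ Y} (hZ : ∀ φ ∈ Z, A φ ∈ Z) {q : ℍ[ℝ]}
    (hq : q ∈ outerResolventSet (restrictTo A Y hY)) {y : V} (hyY : y ∈ Y)
    (hy : pseudoResolvent A q y ∈ Z) : y ∈ Z := by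
  have : CompleteSpace Y := hYc.completeSpace_coe
  refine mem_of_companion_apply_mem (T := (restrictTo A Y hY).restrictScalars ℝ)
    (W := (Z.restrictScalars ℝ).comap (Y.subtype.restrictScalars ℝ))
    (hZc.preimage continuous_subtype_val) (fun w hw => hZ _ hw) isPreconnected_connectedComponentIn
    hq (fun p hp => isUnit_companion_of_notMem_sSpectrum (connectedComponentIn_subset _ _ hp))
    (mem_connectedComponentIn (notMem_sSpectrum_of_mem_outerResolventSet hq)) (w := ⟨y, hyY⟩) ?_
  rw [companion_restrictScalars_apply]
  change (pseudoResolvent (restrictTo A Y hY) q ⟨y, hyY⟩ : V) ∈ Z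
  rwa [coe_pseudoResolvent_restrictTo]

lemma mem_of_pseudoResolvent_mem_of_sup_eq_top (hYc : IsClosed (Y : Set V))
    (hZc : IsClosed (Z : Set V)) {hY : ∀ φ ∈ Y, A φ ∈ Y} (hZ : ∀ φ ∈ Z, A φ ∈ Z) (hYZ : Y ⊔ Z = ⊤)
    {q : ℍ[ℝ]} (hq : q ∈ outerResolventSet (restrictTo A Y hY)) {v : V}
    (hv : pseudoResolvent A q v ∈ Z) : v ∈ Z := by
  obtain ⟨y, hy, z, hz, rfl⟩ := Submodule.mem_sup.1 (hYZ ▸ Submodule.mem_top : v ∈ Y ⊔ Z)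
  rw [map_add] at hv
  exact Z.add_mem (mem_of_pseudoResolvent_mem hYc hZc hZ hq hy
    ((Z.add_mem_iff_left (pseudoResolvent_mem hZ q hz)).1 hv)) hz

-- `infDist v Z` is the norm of `v` in `V ⧸ Z`: the bound inverts `R_q(A)` on that quotient.
lemma exists_infDist_le_mul_norm_pseudoResolvent (hYc : IsClosed (Y : Set V))
    (hZc : IsClosed (Z : Set V)) {hY : ∀ φ ∈ Y, A φ ∈ Y} (hZ : ∀ φ ∈ Z, A φ ∈ Z) (hYZ : Y ⊔ Z = ⊤)
    {K : Set ℍ[ℝ]} (hK : IsCompact K) (hKout : K ⊆ outerResolventSet (restrictTo A Y hY)) :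
    ∃ M, 0 ≤ M ∧ ∀ q ∈ K, ∀ v, Metric.infDist v Z ≤ M * ‖pseudoResolvent A q v‖ := by
  have hKσ : Disjoint K (sSpectrum (restrictTo A Y hY)) :=
    Set.disjoint_left.2 fun q hq => notMem_sSpectrum_of_mem_outerResolventSet (hKout hq)
  obtain ⟨M, hM0, hM⟩ := exists_norm_le_mul_norm_pseudoResolvent hYc hY hK hKσ
  obtain ⟨C, hC0, hC⟩ := exists_add_eq_norm_le (Y := Y.restrictScalars ℝ)
    (Z := Z.restrictScalars ℝ) hYc hZc (by
      rw [← Submodule.restrictScalars_sup, hYZ, Submodule.restrictScalars_top])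
  refine ⟨M * C, by positivity, fun q hq v => ?_⟩
  obtain ⟨y, hy, z, hz, hyz, hyv⟩ := hC (pseudoResolvent A q v)
  obtain ⟨k, hk, rfl⟩ := exists_mem_pseudoResolvent_eq (hKσ.notMem_of_mem_left hq) hy
  have hvk : v - k ∈ Z := by
    refine mem_of_pseudoResolvent_mem_of_sup_eq_top hYc hZc hZ hYZ (hKout hq) ?_
    rwa [map_sub, ← hyz, add_sub_cancel_left]
  calc Metric.infDist v Z ≤ dist v (v - k) := Metric.infDist_le_dist_of_mem hvk
    _ = ‖k‖ := by rw [dist_eq_norm, sub_sub_cancel]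
    _ ≤ M * ‖pseudoResolvent A q k‖ := hM q hq k hk
    _ ≤ M * (C * ‖pseudoResolvent A q v‖) := by gcongr
    _ = M * C * ‖pseudoResolvent A q v‖ := (mul_assoc _ _ _).symm

lemma exists_norm_le_mul_norm_pseudoResolvent_add_infDist (hZc : IsClosed (Z : Set V))
    (hZ : ∀ φ ∈ Z, A φ ∈ Z) {K : Set ℍ[ℝ]} (hK : IsCompact K)
    (hKσ : Disjoint K (sSpectrum (restrictTo A Z hZ))) :
    ∃ M, 0 ≤ M ∧ ∀ q ∈ K, ∀ v,
      ‖v‖ ≤ M * (‖pseudoResolvent A q v‖ + Metric.infDist v Z) := by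
  obtain ⟨M, hM0, hM⟩ := exists_norm_le_mul_norm_pseudoResolvent hZc hZ hK hKσ
  obtain ⟨N, hN0, hN⟩ := exists_norm_pseudoResolvent_apply_le A hK
  refine ⟨M + (1 + M * N), by positivity, fun q hq v => ?_⟩
  calc ‖v‖ ≤ M * ‖pseudoResolvent A q v‖ + (1 + M * N) * Metric.infDist v Z :=
        norm_le_mul_norm_apply_add_mul_infDist (pseudoResolvent A q) ⟨0, Z.zero_mem⟩ hM0 hN0
          (hN q hq) (hM q hq) v
    _ ≤ (M + (1 + M * N)) * ‖pseudoResolvent A q v‖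
        + (M + (1 + M * N)) * Metric.infDist v Z :=
      add_le_add
        (mul_le_mul_of_nonneg_right (le_add_of_nonneg_right (by positivity)) (norm_nonneg _))
        (mul_le_mul_of_nonneg_right (le_add_of_nonneg_left hM0) Metric.infDist_nonneg)
    _ = _ := (mul_add _ _ _).symm

end Operators

section HalfPlane

/-- The point of the closed upper half plane that represents the sphere `{x + y I | I² = -1}`
through a quaternion; the `S`-spectrum is a union of such spheres. -/
noncomputable def halfPlaneCoord (q : ℍ[ℝ]) : ℂ := ⟨q.re, ‖q.im‖⟩

lemma dist_halfPlaneCoord_le (p q : ℍ[ℝ]) :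
    dist (halfPlaneCoord p) (halfPlaneCoord q) ≤ dist p q := by
  rw [Complex.dist_eq_re_im, dist_eq_norm p q, ← Real.sqrt_sq (norm_nonneg (p - q)),
    norm_sq_eq_re_sq_add_norm_im_sq (p - q), Quaternion.re_sub, Quaternion.im_sub]
  exact Real.sqrt_le_sqrt (add_le_add_right (sq_le_sq.2
    ((abs_norm_sub_norm_le p.im q.im).trans (le_abs_self _))) _)

lemma continuous_halfPlaneCoord : Continuous halfPlaneCoord :=
  (LipschitzWith.of_dist_le' (K := 1) fun p q => by
    simpa only [one_mul] using dist_halfPlaneCoord_le p q).continuous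

lemma isometry_coe_add (q : ℍ[ℝ]) : Isometry fun x : ℝ => (x : ℍ[ℝ]) + q :=
  Isometry.of_dist_eq fun x y => by
    rw [dist_add_right, dist_eq_norm, ← Quaternion.coe_sub, Quaternion.norm_coe, Real.dist_eq,
      Real.norm_eq_abs]

lemma dist_halfPlaneCoord_le_of_abs_sub_le {c : ℂ} {q : ℍ[ℝ]} {x : ℝ}
    (hx : |q.re - c.re| ≤ |x - c.re|) :
    dist (halfPlaneCoord q) c ≤ dist (halfPlaneCoord (x + q.im)) c := by
  have hre : (halfPlaneCoord (x + q.im)).re = x := by simp [halfPlaneCoord]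
  have him : (halfPlaneCoord (x + q.im)).im = (halfPlaneCoord q).im := by simp [halfPlaneCoord]
  rw [Complex.dist_eq_re_im, Complex.dist_eq_re_im, hre, him]
  exact Real.sqrt_le_sqrt (add_le_add_left (sq_le_sq.2 hx) _)

-- From a point outside the tube, the horizontal ray pointing away from the tube reaches infinity.
lemma compl_preimage_ball_subset_outerResolventSet {V : Type*} [NormedAddCommGroup V]
    [NormedSpace ℝ V] [Module ℍ[ℝ]ᵐᵒᵖ V] [IsScalarTower ℝ ℍ[ℝ]ᵐᵒᵖ V] {A : V →L[ℍ[ℝ]ᵐᵒᵖ] V} {c : ℂ}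
    {r : ℝ} (hA : sSpectrum A ⊆ halfPlaneCoord ⁻¹' Metric.ball c r) :
    (halfPlaneCoord ⁻¹' Metric.ball c r)ᶜ ⊆ outerResolventSet A := by
  intro q hq
  obtain ⟨J, hJ, hJb, hqJ, hJc⟩ : ∃ J : Set ℝ, IsPreconnected J ∧ ¬ Bornology.IsBounded J ∧
      q.re ∈ J ∧ ∀ x ∈ J, |q.re - c.re| ≤ |x - c.re| := by
    rcases le_total c.re q.re with h | h
    · refine ⟨Set.Ici q.re, isPreconnected_Ici,
        fun hb => not_bddAbove_Ici _ hb.bddAbove, Set.self_mem_Ici, fun x hx => ?_⟩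
      exact abs_le_abs_of_nonneg (sub_nonneg.2 h) (sub_le_sub_right hx _)
    · refine ⟨Set.Iic q.re, isPreconnected_Iic,
        fun hb => not_bddBelow_Iic _ hb.bddBelow, Set.self_mem_Iic, fun x hx => ?_⟩
      exact abs_le_abs_of_nonpos (sub_nonpos.2 h) (sub_le_sub_right hx _)
  have hray : (fun x : ℝ => (x : ℍ[ℝ]) + q.im) '' J ⊆ (sSpectrum A)ᶜ := by
    rintro _ ⟨x, hx, rfl⟩ hxσ
    exact hq ((dist_halfPlaneCoord_le_of_abs_sub_le (hJc x hx)).trans_lt (hA hxσ))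
  have hcomp : (fun x : ℝ => (x : ℍ[ℝ]) + q.im) '' J ⊆
      connectedComponentIn (sSpectrum A)ᶜ q :=
    (hJ.image _ (isometry_coe_add q.im).continuous.continuousOn).subset_connectedComponentIn
      ⟨q.re, hqJ, Quaternion.re_add_im q⟩ hray
  exact fun hb => hJb (((isometry_coe_add q.im).antilipschitz.isBounded_preimage
    (hb.subset hcomp)).subset (Set.subset_preimage_image _ J))

end HalfPlane

section ComplexAnalysis

variable {E : Type*} [NormedAddCommGroup E]

lemma infDist_le_of_forall_mem_frontier [NormedSpace ℂ E] {E' : Type*} [NormedAddCommGroup E']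
    [NormedSpace ℂ E'] [Nontrivial E'] [FiniteDimensional ℂ E'] (p : Submodule ℂ E) {F : E' → E}
    {s : Set E'} (hs : Bornology.IsBounded s) (hF : DiffContOnCl ℂ F s) {C : ℝ}
    (hC : ∀ z ∈ frontier s, Metric.infDist (F z) p ≤ C) {z : E'} (hz : z ∈ closure s) :
    Metric.infDist (F z) p ≤ C := by
  have : IsClosed (p.topologicalClosure : Set E) := p.isClosed_topologicalClosure
  have hnorm : ∀ v : E, ‖p.topologicalClosure.mkQL v‖ = Metric.infDist v p := fun v =>
    (QuotientAddGroup.norm_mk (S := p.topologicalClosure.toAddSubgroup) v).trans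
      (Metric.infDist_closure (s := (p : Set E)))
  simp only [← hnorm] at hC ⊢
  exact Complex.norm_le_of_forall_mem_frontier_norm_le hs
    (p.topologicalClosure.mkQL.differentiable.comp_diffContOnCl hF) hC hz

lemma hasDerivAt_of_hasLineDerivAt {𝕜 G : Type*} [NontriviallyNormedField 𝕜] [NormedSpace 𝕜 E]
    [AddCommGroup G] [Module 𝕜 G] {F : G → E} {F' : E} {x v : G} (hF : HasLineDerivAt 𝕜 F F' x v)
    (t₀ : 𝕜) : HasDerivAt (fun t => F (x + (t - t₀) • v)) F' t₀ := by
  refine HasDerivAt.comp_sub_const t₀ t₀ (f := fun t => F (x + t • v)) ?_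
  rwa [sub_self]

lemma lineDifferentiableAt_comp_iff {𝕜 G H : Type*} [NontriviallyNormedField 𝕜] [NormedSpace 𝕜 E]
    [AddCommGroup G] [Module 𝕜 G] [AddCommGroup H] [Module 𝕜 H] {F : H → E} (L : G →ₗ[𝕜] H)
    {x v : G} : LineDifferentiableAt 𝕜 (F ∘ L) x v ↔ LineDifferentiableAt 𝕜 F (L x) (L v) := by
  simp only [LineDifferentiableAt, Function.comp_apply, map_add, map_smul]

lemma lineDeriv_comp {𝕜 G H : Type*} [NontriviallyNormedField 𝕜] [NormedSpace 𝕜 E]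
    [AddCommGroup G] [Module 𝕜 G] [AddCommGroup H] [Module 𝕜 H] (F : H → E) (L : G →ₗ[𝕜] H)
    (x v : G) : lineDeriv 𝕜 (F ∘ L) x v = lineDeriv 𝕜 F (L x) (L v) := by
  simp only [lineDeriv, Function.comp_apply, map_add, map_smul]

lemma hasStrictFDerivAt_of_continuousOn_lineDeriv [NormedSpace ℝ E] {F : ℂ → E} {s : Set ℂ}
    (hs : IsOpen s) (hd1 : ∀ z ∈ s, LineDifferentiableAt ℝ F z 1)
    (hdI : ∀ z ∈ s, LineDifferentiableAt ℝ F z Complex.I)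
    (hc1 : ContinuousOn (fun z => lineDeriv ℝ F z 1) s)
    (hcI : ContinuousOn (fun z => lineDeriv ℝ F z Complex.I) s) {z : ℂ} (hz : z ∈ s) :
    HasStrictFDerivAt F (Complex.reCLM.smulRight (lineDeriv ℝ F z 1) +
      Complex.imCLM.smulRight (lineDeriv ℝ F z Complex.I)) z := by
  let e := Complex.equivRealProdCLM
  let toMap : E →L[ℝ] ℝ →L[ℝ] E := ContinuousLinearMap.smulRightL ℝ ℝ E 1
  have hre : ∀ (u : ℝ × ℝ) (x : ℝ), e.symm (x, u.2) = e.symm u + (x - u.1) • 1 := fun u x => by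
    apply Complex.ext <;> simp [e]
  have him : ∀ (u : ℝ × ℝ) (y : ℝ), e.symm (u.1, y) = e.symm u + (y - u.2) • Complex.I :=
    fun u y => by apply Complex.ext <;> simp [e]
  have hmem : ∀ᶠ u in 𝓝 (e z), e.symm u ∈ s :=
    (hs.preimage e.symm.continuous).mem_nhds (by simpa using hz)
  have hcont : ∀ H : ℂ → E, ContinuousOn H s →
      ContinuousAt (fun u => toMap (H (e.symm u))) (e z) := fun H hH =>
    toMap.continuous.continuousAt.comp (ContinuousAt.comp (f := e.symm) (g := H)
      (by simpa using hH.continuousAt (hs.mem_nhds hz)) e.symm.continuous.continuousAt)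
  have hprod := hasStrictFDerivAt_uncurry_coprod (𝕜 := ℝ) (u := e z)
    (f := fun x y => F (e.symm (x, y)))
    (f₁ := fun x y => toMap (lineDeriv ℝ F (e.symm (x, y)) 1))
    (f₂ := fun x y => toMap (lineDeriv ℝ F (e.symm (x, y)) Complex.I))
    (hmem.mono fun u hu =>
      ((hasDerivAt_of_hasLineDerivAt (hd1 _ hu).hasLineDerivAt u.1).congr_of_eventuallyEq
        (.of_forall fun x => congrArg F (hre u x))).hasFDerivAt)
    (hmem.mono fun u hu =>
      ((hasDerivAt_of_hasLineDerivAt (hdI _ hu).hasLineDerivAt u.2).congr_of_eventuallyEq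
        (.of_forall fun y => congrArg F (him u y))).hasFDerivAt)
    (hcont _ hc1) (hcont _ hcI)
  exact hprod.comp z e.hasStrictFDerivAt

lemma differentiableOn_of_lineDeriv_cauchyRiemann [NormedSpace ℂ E] [NormedSpace ℝ E]
    [IsScalarTower ℝ ℂ E] {F : ℂ → E} {s : Set ℂ} (hs : IsOpen s)
    (hd1 : ∀ z ∈ s, LineDifferentiableAt ℝ F z 1)
    (hdI : ∀ z ∈ s, LineDifferentiableAt ℝ F z Complex.I)
    (hc1 : ContinuousOn (fun z => lineDeriv ℝ F z 1) s)
    (hcI : ContinuousOn (fun z => lineDeriv ℝ F z Complex.I) s)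
    (hcr : ∀ z ∈ s, lineDeriv ℝ F z 1 + Complex.I • lineDeriv ℝ F z Complex.I = 0) :
    DifferentiableOn ℂ F s := by
  intro z hz
  have hreal := (hasStrictFDerivAt_of_continuousOn_lineDeriv hs hd1 hdI hc1 hcI hz).hasFDerivAt
  have hI : lineDeriv ℝ F z Complex.I = Complex.I • lineDeriv ℝ F z 1 := by
    rw [eq_neg_of_add_eq_zero_left (hcr z hz), smul_neg, smul_smul, Complex.I_mul_I, neg_smul,
      one_smul, neg_neg]
  refine (hasFDerivAt_of_restrictScalars ℝ hreal
    (f' := (1 : ℂ →L[ℂ] ℂ).smulRight (lineDeriv ℝ F z 1)) ?_).differentiableAt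
    |>.differentiableWithinAt
  ext w
  change w • lineDeriv ℝ F z 1 =
    w.re • lineDeriv ℝ F z 1 + w.im • lineDeriv ℝ F z Complex.I
  rw [hI, ← algebraMap_smul ℂ w.re, ← algebraMap_smul ℂ w.im, smul_smul, ← add_smul]
  exact congrArg (· • lineDeriv ℝ F z 1) (Complex.re_add_im w).symm

end ComplexAnalysis

section Slices

/-- The parametrization `x + y i ↦ x + y I` of the slice `ℂ_I`. -/
noncomputable def sliceMap (I : ℍ[ℝ]) : ℂ →L[ℝ] ℍ[ℝ] :=
  Complex.reCLM.smulRight 1 + Complex.imCLM.smulRight I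

lemma sliceMap_apply (I : ℍ[ℝ]) (z : ℂ) : sliceMap I z = z.re + z.im • I := by
  rw [← mul_one (z.re : ℍ[ℝ]), Quaternion.coe_mul_eq_smul]
  rfl

lemma sliceMap_one (I : ℍ[ℝ]) : sliceMap I 1 = 1 := by simp [sliceMap_apply]

lemma sliceMap_I (I : ℍ[ℝ]) : sliceMap I Complex.I = I := by simp [sliceMap_apply]

lemma sliceMap_mem_slicePlane (I : ℍ[ℝ]) (z : ℂ) : sliceMap I z ∈ slicePlane I :=
  ⟨z.re, z.im, by rw [sliceMap_apply, Quaternion.coe_mul_eq_smul]⟩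

variable {I : ℍ[ℝ]}

lemma mul_self_of_mem_imaginaryUnits (hI : I ∈ imaginaryUnits) : I * I = -1 := by
  have hnorm := Quaternion.self_mul_star I
  rw [Quaternion.star_eq_neg.2 hI.1, mul_neg, Quaternion.normSq_eq_norm_mul_self, hI.2, mul_one,
    Quaternion.coe_one] at hnorm
  exact neg_eq_iff_eq_neg.1 hnorm

lemma halfPlaneCoord_sliceMap (hI : I ∈ imaginaryUnits) (z : ℂ) :
    halfPlaneCoord (sliceMap I z) = ⟨z.re, |z.im|⟩ := by
  have him : (sliceMap I z).im = z.im • I := by ext <;> simp [sliceMap_apply, hI.1]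
  apply Complex.ext
  · simp [halfPlaneCoord, sliceMap_apply, hI.1]
  · simp [halfPlaneCoord, him, norm_smul, hI.2]

lemma norm_halfPlaneCoord (q : ℍ[ℝ]) : ‖halfPlaneCoord q‖ = ‖q‖ := by
  rw [← sq_eq_sq₀ (norm_nonneg _) (norm_nonneg _), norm_sq_eq_re_sq_add_norm_im_sq,
    Complex.sq_norm, Complex.normSq_apply, ← pow_two, ← pow_two, halfPlaneCoord]

lemma norm_sliceMap (hI : I ∈ imaginaryUnits) (z : ℂ) : ‖sliceMap I z‖ = ‖z‖ := by
  rw [← norm_halfPlaneCoord, halfPlaneCoord_sliceMap hI,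
    ← sq_eq_sq₀ (norm_nonneg _) (norm_nonneg _), Complex.sq_norm, Complex.sq_norm,
    Complex.normSq_apply, Complex.normSq_apply, abs_mul_abs_self]

lemma dist_sliceMap (hI : I ∈ imaginaryUnits) (z w : ℂ) :
    dist (sliceMap I z) (sliceMap I w) = dist z w := by
  rw [dist_eq_norm, dist_eq_norm, ← map_sub, norm_sliceMap hI]

lemma dist_halfPlaneCoord_sliceMap (hI : I ∈ imaginaryUnits) {c z : ℂ}
    (h : c.im = 0 ∨ 0 ≤ z.im) : dist (halfPlaneCoord (sliceMap I z)) c = dist z c := by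
  rw [halfPlaneCoord_sliceMap hI, Complex.dist_eq_re_im, Complex.dist_eq_re_im]
  rcases h with hc | hz
  · simp only [hc, sub_zero, sq_abs]
  · simp only [abs_of_nonneg hz]

lemma imaginaryUnits_nonempty : imaginaryUnits.Nonempty := by
  obtain ⟨i, hre, hi, hj, hk⟩ : ∃ i : ℍ[ℝ], i.re = 0 ∧ i.imI = 1 ∧ i.imJ = 0 ∧ i.imK = 0 :=
    ⟨⟨0, 1, 0, 0⟩, rfl, rfl, rfl, rfl⟩
  refine ⟨i, hre, (pow_eq_one_iff_of_nonneg (norm_nonneg _) two_ne_zero).1 ?_⟩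
  rw [pow_two, ← Quaternion.normSq_eq_norm_mul_self, Quaternion.normSq_def', hre, hi, hj, hk]
  norm_num

lemma exists_sliceMap_halfPlaneCoord_eq (q : ℍ[ℝ]) :
    ∃ I ∈ imaginaryUnits, sliceMap I (halfPlaneCoord q) = q := by
  obtain ⟨I, hI, hqI⟩ : ∃ I ∈ imaginaryUnits, ‖q.im‖ • I = q.im := by
    rcases eq_or_ne q.im 0 with him | him
    · obtain ⟨I, hI⟩ := imaginaryUnits_nonempty
      exact ⟨I, hI, by rw [him, norm_zero, zero_smul]⟩
    · have hn : ‖q.im‖ ≠ 0 := norm_ne_zero_iff.2 him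
      refine ⟨‖q.im‖⁻¹ • q.im, ⟨by simp, ?_⟩, smul_inv_smul₀ hn _⟩
      rw [norm_smul, norm_inv, norm_norm, inv_mul_cancel₀ hn]
  refine ⟨I, hI, ?_⟩
  rw [sliceMap_apply, halfPlaneCoord, hqI, Quaternion.re_add_im]

/-- Right multiplication by the points of the slice `ℂ_I`, as a representation of `ℂ`. -/
noncomputable def opSliceHom (hI : I ∈ imaginaryUnits) : ℂ →ₐ[ℝ] ℍ[ℝ]ᵐᵒᵖ :=
  Complex.liftAux (.op I) (by rw [← MulOpposite.op_mul, mul_self_of_mem_imaginaryUnits hI]; rfl)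

lemma opSliceHom_apply (hI : I ∈ imaginaryUnits) (z : ℂ) :
    opSliceHom hI z = .op (sliceMap I z) := by
  rw [opSliceHom, Complex.liftAux_apply, Algebra.algebraMap_eq_smul_one]
  rfl

variable {V : Type*} [NormedAddCommGroup V] [Module ℍ[ℝ]ᵐᵒᵖ V] [NormSMulClass ℍ[ℝ]ᵐᵒᵖ V]

/-- The complex structure on a right quaternionic space in which `i` acts as right multiplication
by the imaginary unit `I`. -/
noncomputable abbrev sliceNormedSpace (hI : I ∈ imaginaryUnits) : NormedSpace ℂ V where
  toModule := Module.compHom V (opSliceHom hI).toRingHom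
  norm_smul_le z v := by
    change ‖opSliceHom hI z • v‖ ≤ ‖z‖ * ‖v‖
    rw [norm_smul, opSliceHom_apply, MulOpposite.norm_op, norm_sliceMap hI]

/-- Holomorphy of `f` on every slice of `U`, for the complex structure on `V` that the slice
induces. -/
def IsRightSliceHolomorphicOn (f : ℍ[ℝ] → V) (U : Set ℍ[ℝ]) : Prop :=
  ∀ (I : ℍ[ℝ]) (hI : I ∈ imaginaryUnits),
    letI := sliceNormedSpace (V := V) hI
    DifferentiableOn ℂ (f ∘ sliceMap I) (sliceMap I ⁻¹' U)

lemma IsRightSliceRegularOn.isRightSliceHolomorphicOn [NormedSpace ℝ V] [IsScalarTower ℝ ℍ[ℝ]ᵐᵒᵖ V]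
    {f : ℍ[ℝ] → V} {U : Set ℍ[ℝ]} (hf : IsRightSliceRegularOn f U) (hU : IsOpen U) :
    IsRightSliceHolomorphicOn f U := by
  intro I hI
  let := sliceNormedSpace (V := V) hI
  have hsmul : ∀ (z : ℂ) (v : V), z • v = opSliceHom hI z • v := fun _ _ => rfl
  have : IsScalarTower ℝ ℂ V := ⟨fun a z v => by rw [hsmul, hsmul, map_smul, smul_assoc]⟩
  have hmaps : Set.MapsTo (sliceMap I) (sliceMap I ⁻¹' U) (U ∩ slicePlane I) := fun z hz =>
    ⟨hz, sliceMap_mem_slicePlane I z⟩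
  have hcont : ContinuousOn (sliceMap I) (sliceMap I ⁻¹' U) := (sliceMap I).continuous.continuousOn
  have hderiv : ∀ z v,
      lineDeriv ℝ (f ∘ sliceMap I) z v = lineDeriv ℝ f (sliceMap I z) (sliceMap I v) :=
    lineDeriv_comp f (sliceMap I).toLinearMap
  have hdiff := fun z (hz : z ∈ sliceMap I ⁻¹' U) => hf.slice_differentiable I hI _ (hmaps hz)
  refine differentiableOn_of_lineDeriv_cauchyRiemann (hU.preimage (sliceMap I).continuous)
    (fun z hz => ?_) (fun z hz => ?_) ?_ ?_ fun z hz => ?_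
  · exact (lineDifferentiableAt_comp_iff (sliceMap I).toLinearMap).2
      ((sliceMap_one I).symm ▸ (hdiff z hz).1)
  · exact (lineDifferentiableAt_comp_iff (sliceMap I).toLinearMap).2
      ((sliceMap_I I).symm ▸ (hdiff z hz).2)
  · simp only [hderiv, sliceMap_one]
    exact (hf.slice_continuous I hI).1.comp hcont hmaps
  · simp only [hderiv, sliceMap_I]
    exact (hf.slice_continuous I hI).2.comp hcont hmaps
  · rw [hderiv, hderiv, sliceMap_one, sliceMap_I, hsmul, opSliceHom_apply, sliceMap_I]
    exact (smul_eq_zero_iff_right (by norm_num)).1 (hf.cauchy_riemann I hI _ (hmaps hz))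

namespace IsRightSliceHolomorphicOn

variable {f : ℍ[ℝ] → V} {U : Set ℍ[ℝ]} {C r : ℝ}

lemma infDist_le_of_forall_mem_sphere (hf : IsRightSliceHolomorphicOn f U)
    (Z : Submodule ℍ[ℝ]ᵐᵒᵖ V) (hI : I ∈ imaginaryUnits) {c : ℂ} (hr : r ≠ 0)
    (hU : Set.MapsTo (sliceMap I) (Metric.closedBall c r) U)
    (hC : ∀ z ∈ Metric.sphere c r, Metric.infDist (f (sliceMap I z)) Z ≤ C) {z : ℂ}
    (hz : z ∈ Metric.closedBall c r) : Metric.infDist (f (sliceMap I z)) Z ≤ C := by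
  let := sliceNormedSpace (V := V) hI
  let p : Submodule ℂ V :=
    { Z.toAddSubmonoid with smul_mem' := fun z _ hv => Z.smul_mem (opSliceHom hI z) hv }
  exact infDist_le_of_forall_mem_frontier p Metric.isBounded_ball ((hf I hI).diffContOnCl_ball hU)
    (fun w hw => hC w (frontier_ball c hr ▸ hw)) (by rwa [closure_ball c hr])

lemma infDist_le_of_forall_halfPlaneCoord_notMem_ball (hf : IsRightSliceHolomorphicOn f U)
    (Z : Submodule ℍ[ℝ]ᵐᵒᵖ V) {p q : ℍ[ℝ]} (hr : 0 < r) (hp : ‖p.im‖ = 0 ∨ 2 * r ≤ ‖p.im‖)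
    (hU : Metric.closedBall p (4 * r) ⊆ U)
    (hC : ∀ q ∈ Metric.closedBall p (4 * r),
      halfPlaneCoord q ∉ Metric.ball (halfPlaneCoord p) (2 * r) → Metric.infDist (f q) Z ≤ C)
    (hq : q ∈ Metric.closedBall p r) : Metric.infDist (f q) Z ≤ C := by
  obtain ⟨I, hI, hqI⟩ := exists_sliceMap_halfPlaneCoord_eq q
  have hcoord : dist (halfPlaneCoord q) (halfPlaneCoord p) ≤ r :=
    (dist_halfPlaneCoord_le q p).trans hq
  have hmaps : Set.MapsTo (sliceMap I) (Metric.closedBall (halfPlaneCoord p) (2 * r))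
      (Metric.closedBall p (4 * r)) := fun z hz => by
    calc dist (sliceMap I z) p
        ≤ dist (sliceMap I z) (sliceMap I (halfPlaneCoord q)) + dist q p := by
          rw [hqI]; exact dist_triangle _ _ _
      _ ≤ (dist z (halfPlaneCoord p) + dist (halfPlaneCoord q) (halfPlaneCoord p)) + dist q p := by
          rw [dist_sliceMap hI]; gcongr; exact dist_triangle_right _ _ _
      _ ≤ (2 * r + r) + r := add_le_add (add_le_add hz hcoord) hq
      _ = 4 * r := by ring
  rw [← hqI]
  refine hf.infDist_le_of_forall_mem_sphere Z hI (by positivity) (hmaps.mono_right hU)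
    (fun z hz => hC _ (hmaps (Metric.sphere_subset_closedBall hz)) ?_)
    (hcoord.trans (by linarith))
  have hz_im : (halfPlaneCoord p).im = 0 ∨ 0 ≤ z.im := hp.imp_right fun hp => by
    have him : |z.im - ‖p.im‖| ≤ 2 * r := by
      rw [← Metric.mem_sphere.1 hz, dist_eq_norm]
      exact Complex.abs_im_le_norm (z - halfPlaneCoord p)
    linarith [(abs_le.1 him).1]
  rw [Metric.mem_ball, dist_halfPlaneCoord_sliceMap hI hz_im, Metric.mem_sphere.1 hz]
  exact lt_irrefl _

end IsRightSliceHolomorphicOn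

end Slices

section BishopProperty

variable {V : Type*} [NormedAddCommGroup V] [NormedSpace ℝ V] [Module ℍ[ℝ]ᵐᵒᵖ V]
  [IsScalarTower ℝ ℍ[ℝ]ᵐᵒᵖ V] {A : V →L[ℍ[ℝ]ᵐᵒᵖ] V}

lemma IsDecomposable.exists_restrictTo_subset_ball (hA : IsDecomposable A) (c : ℂ) {r s : ℝ}
    (hrs : r < s) :
    ∃ (Y Z : Submodule ℍ[ℝ]ᵐᵒᵖ V) (hY : ∀ φ ∈ Y, A φ ∈ Y) (hZ : ∀ φ ∈ Z, A φ ∈ Z),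
      IsClosed (Y : Set V) ∧ IsClosed (Z : Set V) ∧
      sSpectrum (restrictTo A Y hY) ⊆ halfPlaneCoord ⁻¹' Metric.ball c s ∧
      sSpectrum (restrictTo A Z hZ) ⊆ halfPlaneCoord ⁻¹' (Metric.closedBall c r)ᶜ ∧
      Y ⊔ Z = ⊤ := by
  refine hA _ _ (Metric.isOpen_ball.preimage continuous_halfPlaneCoord)
    (Metric.isClosed_closedBall.isOpen_compl.preimage continuous_halfPlaneCoord) ?_
  rw [← Set.preimage_union, Set.eq_univ_iff_forall]
  intro q
  by_cases hq : halfPlaneCoord q ∈ Metric.closedBall c r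
  · exact .inl (Metric.closedBall_subset_ball hrs hq)
  · exact .inr hq

lemma IsDecomposable.exists_norm_le [CompleteSpace V] [NormSMulClass ℍ[ℝ]ᵐᵒᵖ V]
    (hA : IsDecomposable A) {p : ℍ[ℝ]} {r : ℝ} (hr : 0 < r)
    (hp : ‖p.im‖ = 0 ∨ 2 * r ≤ ‖p.im‖) :
    ∃ B, ∀ U, Metric.closedBall p (4 * r) ⊆ U → ∀ f, IsRightSliceHolomorphicOn f U →
      ∀ η, (∀ q ∈ Metric.closedBall p (4 * r), ‖pseudoResolvent A q (f q)‖ ≤ η) →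
        ∀ q ∈ Metric.closedBall p r, ‖f q‖ ≤ B * η := by
  obtain ⟨Y, Z, hY, hZ, hYc, hZc, hσY, hσZ, hYZ⟩ :=
    hA.exists_restrictTo_subset_ball (halfPlaneCoord p) (s := 2 * r) (by linarith : r < 2 * r)
  have htube : IsOpen (halfPlaneCoord ⁻¹' Metric.ball (halfPlaneCoord p) (2 * r)) :=
    Metric.isOpen_ball.preimage continuous_halfPlaneCoord
  obtain ⟨M, hM0, hM⟩ := exists_infDist_le_mul_norm_pseudoResolvent hYc hZc hZ hYZ
    ((isCompact_closedBall p (4 * r)).inter_right htube.isClosed_compl)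
    (Set.inter_subset_right.trans (compl_preimage_ball_subset_outerResolventSet hσY))
  obtain ⟨N, hN0, hN⟩ := exists_norm_le_mul_norm_pseudoResolvent_add_infDist hZc hZ
    (isCompact_closedBall p r) (Set.disjoint_left.2 fun q hq hqσ =>
      hσZ hqσ ((dist_halfPlaneCoord_le q p).trans hq))
  refine ⟨N * (1 + M), fun U hU f hf η hη q hq => ?_⟩
  have hdist : Metric.infDist (f q) Z ≤ M * η :=
    hf.infDist_le_of_forall_halfPlaneCoord_notMem_ball Z hr hp hU (fun q' hq' hout =>
      (hM q' ⟨hq', hout⟩ _).trans (mul_le_mul_of_nonneg_left (hη q' hq') hM0)) hq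
  calc ‖f q‖ ≤ N * (‖pseudoResolvent A q (f q)‖ + Metric.infDist (f q) Z) := hN q hq _
    _ ≤ N * (η + M * η) := by
      gcongr
      exact hη q (Metric.closedBall_subset_closedBall (by linarith) hq)
    _ = N * (1 + M) * η := by ring

lemma exists_closedBall_subset_of_mem_nhds {p : ℍ[ℝ]} {U : Set ℍ[ℝ]} (hU : U ∈ 𝓝 p) :
    ∃ r > 0, Metric.closedBall p (4 * r) ⊆ U ∧ (‖p.im‖ = 0 ∨ 2 * r ≤ ‖p.im‖) := by
  obtain ⟨R, hR, hRU⟩ := Metric.nhds_basis_closedBall.mem_iff.1 hU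
  rcases (norm_nonneg p.im).eq_or_lt' with him | him
  · exact ⟨R / 4, by positivity, by rwa [mul_div_cancel₀ R four_ne_zero], .inl him⟩
  · refine ⟨min (R / 4) (‖p.im‖ / 2), by positivity, ?_, .inr ?_⟩
    · refine (Metric.closedBall_subset_closedBall ?_).trans hRU
      linarith [min_le_left (R / 4) (‖p.im‖ / 2)]
    · linarith [min_le_right (R / 4) (‖p.im‖ / 2)]

end BishopProperty

end QuaternionicOperator

open QuaternionicOperator in
theorem theorem1p2p7_general {V : Type*} [NormedAddCommGroup V] [NormedSpace ℝ V]
    [CompleteSpace V] [Module ℍ[ℝ]ᵐᵒᵖ V] [IsScalarTower ℝ ℍ[ℝ]ᵐᵒᵖ V] [NormSMulClass ℍ[ℝ]ᵐᵒᵖ V]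
    {A : V →L[ℍ[ℝ]ᵐᵒᵖ] V} (hA : IsDecomposable A) {U : Set ℍ[ℝ]} (hU : IsOpen U) {ι : Type*}
    {l : Filter ι} {f : ι → ℍ[ℝ] → V} (hf : ∀ n, IsRightSliceHolomorphicOn (f n) U)
    (hlim : ∀ K ⊆ U, IsCompact K →
      TendstoUniformlyOn (fun n q => pseudoResolvent A q (f n q)) 0 l K) :
    TendstoLocallyUniformlyOn f 0 l U := by
  refine Metric.tendstoLocallyUniformlyOn_iff.2 fun ε hε p hp => ?_
  obtain ⟨r, hr, hrU, him⟩ := exists_closedBall_subset_of_mem_nhds (hU.mem_nhds hp)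
  obtain ⟨B, hB⟩ := hA.exists_norm_le hr him
  obtain ⟨η, hη, hBη⟩ := exists_pos_mul_lt hε B
  refine ⟨Metric.closedBall p r,
    mem_nhdsWithin_of_mem_nhds (Metric.closedBall_mem_nhds p hr), ?_⟩
  filter_upwards [Metric.tendstoUniformlyOn_iff.1
    (hlim _ hrU (isCompact_closedBall p (4 * r))) η hη] with n hn q hq
  simp only [Pi.zero_apply, dist_zero_left] at hn ⊢
  exact (hB U hrU (f n) (hf n) η (fun q hq => (hn q hq).le) q hq).trans_lt hBη

theorem theorem1p2p7 {V : Type*} [NormedAddCommGroup V] [NormedSpace ℝ V] [CompleteSpace V]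
    [Module (Quaternion ℝ)ᵐᵒᵖ V] [IsScalarTower ℝ (Quaternion ℝ)ᵐᵒᵖ V]
    [NormSMulClass (Quaternion ℝ)ᵐᵒᵖ V]
    (A : V →L[(Quaternion ℝ)ᵐᵒᵖ] V) (hA : QuaternionicOperator.IsDecomposable A) :
    QuaternionicOperator.HasBishopProperty A :=
  fun _ hU _ hf hlim =>
    theorem1p2p7_general hA hU (fun n => (hf n).2.isRightSliceHolomorphicOn hU) hlim
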